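/- Consider finite or infinite simple graphs whose edges are properly coloured with $k$ colours (adjacent edges get distinct colours). A deterministic distributed algorithm for anonymous $k$-edge-coloured graphs runs the same state machine in every node. Initially a node knows only the set of colours of its incident edges. In each synchronous round every node sends a message along each incident edge, receives a message along each incident edge (it can tell the colours of these edges), and updates its state. Initially, and after each round, a node may stop and irrevocably announce its local output: unmatched, or matched along its incident edge of colour $c$. Messages, states and local computations are unrestricted, and the algorithm may depend on $k$ and $\Delta$. It finds a maximal matching in $r$ rounds in a graph if all nodes stop within $r$ rounds and the outputs consistently describe a maximal matching. Let $\log^* x$ be the number of times the binary logarithm has to be iterated, starting from $x$, until the value is at most $1$. 1. (Lower bound $\Omega(\Delta)$.) There is an absolute constant $a>0$ such that for all integers $k\ge\Delta\ge 2$, every deterministic distributed algorithm that finds a maximal matching in $r$ rounds in every anonymous, $k$-edge-coloured graph of maximum degree $\Delta$ has $r\ge a\Delta$. 2. (Complexity $\Theta(\Delta+\log^* k)$.) There are absolute constants $b,B>0$ such that for all integers $k\ge\Delta\ge 2$, every such algorithm has $r\ge b(\Delta+\log^* k)$; and there is a deterministic distributed algorithm that finds a maximal matching in at most $B(\Delta+\log^*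 k)$ rounds in every anonymous, $k$-edge-coloured graph of maximum degree at most $\Delta$. The lower bounds hold already for algorithms that are only required to work on finite graphs of maximum degree exactly $\Delta$; the algorithm in part 2 works on all graphs, finite or infinite, of maximum degree at most $\Delta$. -/

import Mathlib

namespace EdgeColouredLocal

/-- A simple graph on `V` with a proper edge colouring by `k` colours:
distinct edges at a common node have distinct colours. -/
structure ColouredGraph (k : ℕ) (V : Type) where
  graph : SimpleGraph V
  colour : graph.EdgeLabeling (Fin k)
  proper : ∀ (u v w : V) (hv : graph.Adj u v) (hw : graph.Adj u w),
    colour.get u v hv = colour.get u w hw → v = w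

namespace ColouredGraph

variable {k : ℕ} {V : Type}

/-- `G.Joins c v w`: there is an edge of colour `c` between `v` and `w`. -/
def Joins (G : ColouredGraph k V) (c : Fin k) (v w : V) : Prop :=
  (G.colour.labelGraph c).Adj v w

theorem joins_iff (G : ColouredGraph k V) (c : Fin k) (v w : V) :
    G.Joins c v w ↔ ∃ h : G.graph.Adj v w, G.colour.get v w h = c :=
  SimpleGraph.EdgeLabeling.labelGraph_adj v w

theorem Joins.unique {G : ColouredGraph k V} {c : Fin k} {v w w' : V}
    (h : G.Joins c v w) (h' : G.Joins c v w') : w = w' := by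
  obtain ⟨a, ha⟩ := (G.joins_iff c v w).1 h
  obtain ⟨b, hb⟩ := (G.joins_iff c v w').1 h'
  exact G.proper v w w' a b (ha.trans hb.symm)

open Classical in
/-- The set of colours of the edges incident to `v`. -/
noncomputable def incidentColours (G : ColouredGraph k V) (v : V) : Finset (Fin k) :=
  Finset.univ.filter fun c => ∃ w, G.Joins c v w

open Classical in
/-- The neighbour of `v` along the edge of colour `c`, if `v` has an incident edge of colour `c`
(the neighbour is then unique by `Joins.unique`). -/
noncomputable def neighbour (G : ColouredGraph k V) (v : V) (c : Fin k) : Option V :=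
  if h : ∃ w, G.Joins c v w then some h.choose else none

/-- Every node has at most `Δ` neighbours. -/
def MaxDegreeAtMost (G : ColouredGraph k V) (Δ : ℕ) : Prop :=
  ∀ v, (G.graph.neighborSet v).encard ≤ Δ

/-- The maximum degree of the graph is (attained and) equal to `Δ`. -/
def MaxDegreeEq (G : ColouredGraph k V) (Δ : ℕ) : Prop :=
  G.MaxDegreeAtMost Δ ∧ ∃ v, (G.graph.neighborSet v).encard = Δ

/-- Local outputs describe a matching: `o v = none` says that `v` is unmatched, and `o v = some c`
that `v` is matched along its edge of colour `c`.
The outputs have to be consistent, and the matching they describe has to be maximal. -/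
structure IsMaximalMatching (G : ColouredGraph k V) (o : V → Option (Fin k)) : Prop where
  incident : ∀ v c, o v = some c → c ∈ G.incidentColours v
  consistent : ∀ v w c, o v = some c → G.Joins c v w → o w = some c
  maximal : ∀ v w, o v = none → G.graph.Adj v w → o w ≠ none

end ColouredGraph

/-- A deterministic distributed algorithm for anonymous graphs that are properly edge-coloured
with `k` colours. All nodes run the same state machine; states and messages are arbitrary.
* `init S` is the initial state of a node whose incident edges have the set of colours `S`;
* `send s c` is the message that a node in state `s` sends along its edge of colour `c`;
* `update s m` is the new state of a node in state `s` that receives `m c` along its edge of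
  colour `c` (`m c = none` if it has no such edge);
* `output s` is `none` as long as a node in state `s` goes on, and `some o` if it has stopped and
  announced the local output `o`. -/
structure Algorithm (k : ℕ) where
  State : Type
  Msg : Type
  init : Finset (Fin k) → State
  send : State → Fin k → Msg
  update : State → (Fin k → Option Msg) → State
  output : State → Option (Option (Fin k))

namespace Algorithm

variable {k : ℕ} {V : Type}

/-- The state of each node after `t` synchronous communication rounds.
A node that has stopped never changes its state again. -/
noncomputable def stateAfter (A : Algorithm k) (G : ColouredGraph k V) : ℕ → V → A.State
  | 0, v => A.init (G.incidentColours v)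
  | t + 1, v =>
      if (A.output (A.stateAfter G t v)).isSome then A.stateAfter G t v
      else A.update (A.stateAfter G t v) fun c =>
        (G.neighbour v c).map fun w => A.send (A.stateAfter G t w) c

/-- Run on `G`, all nodes stop within `r` rounds, and their local outputs form a maximal
matching. -/
def FindsMaximalMatching (A : Algorithm k) (G : ColouredGraph k V) (r : ℕ) : Prop :=
  ∃ o : V → Option (Fin k),
    (∀ v, A.output (A.stateAfter G r v) = some (o v)) ∧ G.IsMaximalMatching o

/-- `A` finds a maximal matching within `r` rounds in every finite graph of maximum degree
exactly `Δ`, for every proper `k`-edge-colouring of it. -/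
def SolvesFinite (A : Algorithm k) (Δ r : ℕ) : Prop :=
  ∀ (V : Type) [Finite V] (G : ColouredGraph k V), G.MaxDegreeEq Δ → A.FindsMaximalMatching G r

/-- `A` finds a maximal matching within `r` rounds in every graph, finite or infinite, of maximum
degree at most `Δ`, for every proper `k`-edge-colouring of it. -/
def SolvesAll (A : Algorithm k) (Δ r : ℕ) : Prop :=
  ∀ (V : Type) (G : ColouredGraph k V), G.MaxDegreeAtMost Δ → A.FindsMaximalMatching G r

end Algorithm

/-- `log* x`: how often the binary logarithm has to be iterated, starting from `x`, until the
value is at most `1`. -/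
noncomputable def logStar (x : ℝ) : ℕ :=
  sInf {n : ℕ | (Real.logb 2)^[n] x ≤ 1}

end EdgeColouredLocal

namespace EdgeColouredLocal

/-! Deterministic anonymous algorithms cannot tell a graph from its covers
(`Algorithm.runOn_cover`). Every finite properly coloured graph with loops and parallel edges has a
finite simple cover of the same degrees, so a correct algorithm must also behave consistently on
graphs with loops (`exists_matchingOutput`), where a node may be matched to itself. A node with a
loop can never stay unmatched.

Lower bound in `Δ`: take a loop of colour `c` at `g` in one graph and at `h` in another, such that
`g` and `h` look alike in fewer than `i` rounds although only one of the two loops is used in the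
final output. Cut both loops and join `g` to `h`. The new edge is either used or not, so at one end,
say `g`, the decision has changed. Each output matches every node, possibly to itself, so the number
of loops used has a fixed parity; hence the decision also changes at another loop of the graph of
`g` (`exists_second_loop`). News of the mixing needs one more round to get there, which yields a
pair for `i + 1` at the cost of one loop per node (`HasSeparatedLoops.succ`). Starting from a single
node with `Δ` loops, this can be iterated `Δ - 2` times.

Lower bound in `log* k`: on a cycle whose edges carry an increasing list of colours, the direction
in which a node is matched is a 3-colouring of windows of `2r + 2` colours, and consecutive windows
differ. This is a 3-colouring of a shift graph, so `k` is at most a tower of height `2r + 3`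
(`Algorithm.SolvesFinite.le_tower`).

Upper bound: for each `i`, let every node point along its edge of `i`-th smallest colour.
Cole–Vishkin reduction brings the labels of each such pointer graph below 8 in `log* k` rounds. The
edges are then processed greedily in `9Δ` phases of two rounds, by index and label, with a ninth
class for edges that have the same index at both ends (`matched_of_phase`,
`solvesAll_matchingAlgorithm`). -/

/-! ### Running algorithms on edge-coloured graphs with loops -/

/-- The run of an algorithm on a graph given by its coloured adjacencies; loops are allowed. -/
noncomputable def Algorithm.runOn {k : ℕ} {V : Type} (A : Algorithm k)
    (nbr : V → Fin k → Option V) : ℕ → V → A.State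
  | 0, v => A.init (Finset.univ.filter fun c => (nbr v c).isSome)
  | t + 1, v =>
      if (A.output (A.runOn nbr t v)).isSome then A.runOn nbr t v
      else A.update (A.runOn nbr t v) fun c => (nbr v c).map fun w => A.send (A.runOn nbr t w) c

/-- Coloured adjacency is symmetric. -/
def Reciprocal {k : ℕ} {V : Type} (nbr : V → Fin k → Option V) : Prop :=
  ∀ v w c, nbr v c = some w → nbr w c = some v

/-! ### Simple coloured graphs as partial neighbour functions -/

namespace ColouredGraph

variable {k : ℕ} {V : Type} (G : ColouredGraph k V)

theorem neighbour_eq_some {v w : V} {c : Fin k} :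
    G.neighbour v c = some w ↔ G.Joins c v w := by
  unfold neighbour
  split_ifs with h
  · rw [Option.some_inj]
    exact ⟨fun e => e ▸ h.choose_spec, fun hw => h.choose_spec.unique hw⟩
  · simp only [false_iff]
    exact fun hw => h ⟨w, hw⟩

theorem reciprocal_neighbour : Reciprocal G.neighbour := fun _ _ _ h =>
  G.neighbour_eq_some.2 ((G.neighbour_eq_some.1 h).symm)

theorem incidentColours_eq (v : V) :
    G.incidentColours v = Finset.univ.filter fun c => (G.neighbour v c).isSome := by
  ext c
  simp [incidentColours, Option.isSome_iff_exists, neighbour_eq_some]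

theorem exists_joins_iff {v w : V} : (∃ c, G.Joins c v w) ↔ G.graph.Adj v w := by
  simp only [joins_iff]
  exact ⟨fun ⟨_, h, _⟩ => h, fun h => ⟨_, h, rfl⟩⟩

theorem Joins.colour_unique {G : ColouredGraph k V} {c c' : Fin k} {v w : V}
    (h : G.Joins c v w) (h' : G.Joins c' v w) : c = c' := by
  obtain ⟨a, ha⟩ := (G.joins_iff c v w).1 h
  obtain ⟨b, hb⟩ := (G.joins_iff c' v w).1 h'
  exact ha.symm.trans hb

theorem encard_neighborSet (v : V) :
    (G.graph.neighborSet v).encard = (G.incidentColours v).card := by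
  have hinj : Set.InjOn (fun c => (G.neighbour v c).getD v) (G.incidentColours v) := by
    intro c hc c' hc' h
    simp only [incidentColours, Finset.coe_filter, Finset.mem_univ, true_and,
      Set.mem_ofPred_eq] at hc hc'
    obtain ⟨w, hw⟩ := hc
    obtain ⟨w', hw'⟩ := hc'
    simp only [G.neighbour_eq_some.2 hw, G.neighbour_eq_some.2 hw', Option.getD_some] at h
    exact hw.colour_unique (h ▸ hw')
  have himg : (fun c => (G.neighbour v c).getD v) '' (G.incidentColours v) =
      G.graph.neighborSet v := by
    ext w
    simp only [incidentColours, Set.mem_image, Finset.coe_filter, Finset.mem_univ, true_and,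
      Set.mem_ofPred_eq, SimpleGraph.mem_neighborSet, ← G.exists_joins_iff]
    constructor
    · rintro ⟨c, ⟨w', hw'⟩, h⟩
      rw [G.neighbour_eq_some.2 hw', Option.getD_some] at h
      exact ⟨c, h ▸ hw'⟩
    · rintro ⟨c, hc⟩
      exact ⟨c, ⟨w, hc⟩, by rw [G.neighbour_eq_some.2 hc, Option.getD_some]⟩
  rw [← himg, hinj.encard_image, Set.encard_coe_eq_coe_finsetCard]

theorem stateAfter_eq_runOn (A : Algorithm k) (t : ℕ) :
    ∀ v, A.stateAfter G t v = A.runOn G.neighbour t v := by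
  induction t with
  | zero => intro v; simp only [Algorithm.stateAfter, Algorithm.runOn, incidentColours_eq]
  | succ t ih => intro v; simp only [Algorithm.stateAfter, Algorithm.runOn, ih]

open Classical in
/-- The simple graph with given coloured adjacencies, where distinct colours lead to distinct
neighbours. -/
noncomputable def ofNbr (nbr : V → Fin k → Option V) (hs : Reciprocal nbr)
    (hl : ∀ v c, nbr v c ≠ some v) (hm : ∀ v w c d, nbr v c = some w → nbr v d = some w → c = d) :
    ColouredGraph k V where
  graph :=
    { Adj := fun v w => ∃ c, nbr v c = some w
      symm := ⟨fun v w ⟨c, h⟩ => ⟨c, hs v w c h⟩⟩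
      loopless := ⟨fun v ⟨c, h⟩ => hl v c h⟩ }
  colour := SimpleGraph.EdgeLabeling.mk (fun _ _ h => h.choose)
    fun v w h =>
      have h' : ∃ c, nbr w c = some v := h.symm
      hm v w _ _ (hs w v _ h'.choose_spec) h.choose_spec
  proper := by
    intro u v w hv hw h
    simp only [SimpleGraph.EdgeLabeling.get_mk] at h
    have h1 := hv.choose_spec
    rw [h, hw.choose_spec] at h1
    exact (Option.some_inj.1 h1).symm

theorem neighbour_ofNbr (nbr : V → Fin k → Option V) (hs : Reciprocal nbr)
    (hl : ∀ v c, nbr v c ≠ some v) (hm : ∀ v w c d, nbr v c = some w → nbr v d = some w → c = d) :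
    (ofNbr nbr hs hl hm).neighbour = nbr := by
  ext v c w
  rw [neighbour_eq_some, joins_iff]
  constructor
  · rintro ⟨h, rfl⟩
    have h' : ∃ c, nbr v c = some w := h
    exact h'.choose_spec
  · intro h
    have h' : ∃ c, nbr v c = some w := ⟨c, h⟩
    exact ⟨h', hm v w _ _ h'.choose_spec h⟩

end ColouredGraph

variable {k : ℕ} {V W : Type}

theorem Algorithm.runOn_succ_congr (A : Algorithm k) {N : V → Fin k → Option V}
    {M : W → Fin k → Option W} {t : ℕ} {v : V} {w : W} (h : A.runOn N t v = A.runOn M t w)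
    (hn : ∀ c, (N v c).map (A.runOn N t) = (M w c).map (A.runOn M t)) :
    A.runOn N (t + 1) v = A.runOn M (t + 1) w := by
  have hn' : (fun c => (N v c).map fun u => A.send (A.runOn N t u) c) =
      fun c => (M w c).map fun u => A.send (A.runOn M t u) c := by
    funext c
    have := congrArg (Option.map fun s => A.send s c) (hn c)
    simpa only [Option.map_map, Function.comp_def] using this
  simp only [runOn, h, hn']

theorem Algorithm.runOn_zero_congr (A : Algorithm k) {N : V → Fin k → Option V}
    {M : W → Fin k → Option W} {v : V} {w : W} (hn : ∀ c, (N v c).isSome = (M w c).isSome) :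
    A.runOn N 0 v = A.runOn M 0 w := by
  simp only [runOn, hn]

/-- Algorithms do not distinguish a graph from its covers. -/
theorem Algorithm.runOn_cover (A : Algorithm k) {N : V → Fin k → Option V}
    {M : W → Fin k → Option W} (π : W → V) (hπ : ∀ w c, N (π w) c = (M w c).map π) (t : ℕ) :
    ∀ w, A.runOn M t w = A.runOn N t (π w) := by
  induction t with
  | zero => exact fun w => A.runOn_zero_congr fun c => by simp [hπ]
  | succ t ih =>
    refine fun w => A.runOn_succ_congr (ih w) fun c => ?_
    rw [hπ, Option.map_map]
    congr 1
    exact funext ih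

/-- The outputs `o` of all nodes, in a graph that may have loops, form a maximal matching;
a node with a loop may be matched to itself. -/
structure MatchingOutput (N : V → Fin k → Option V) (o : V → Option (Fin k)) : Prop where
  mate : ∀ v c, o v = some c → ∃ w, N v c = some w ∧ o w = some c
  maximal : ∀ v w c, N v c = some w → o v = none → o w ≠ none

/-- The double cover for every colour separately: it is simple. -/
def simpleCover (N : V → Fin k → Option V) (p : V × (Fin k → Bool)) (c : Fin k) :
    Option (V × (Fin k → Bool)) :=
  (N p.1 c).map fun w => (w, Function.update p.2 c (!p.2 c))

theorem simpleCover_eq_some {N : V → Fin k → Option V} {p q : V × (Fin k → Bool)} {c : Fin k} :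
    simpleCover N p c = some q ↔
      N p.1 c = some q.1 ∧ q.2 = Function.update p.2 c (!p.2 c) := by
  obtain ⟨v, x⟩ := p
  obtain ⟨w, y⟩ := q
  simp only [simpleCover, Option.map_eq_some_iff, Prod.mk.injEq]
  constructor
  · rintro ⟨a, h, rfl, rfl⟩; exact ⟨h, rfl⟩
  · rintro ⟨h, rfl⟩; exact ⟨w, h, rfl, rfl⟩

theorem update_not_ne (x : Fin k → Bool) (c : Fin k) : Function.update x c (!x c) ≠ x := by
  intro h
  simpa using congrFun h c

/-- An algorithm for finite simple graphs of maximum degree `Δ` also works on finite graphs with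
loops and parallel edges that have a node of degree `Δ`. -/
theorem exists_matchingOutput_of_degree [Finite V] {Δ r : ℕ} {A : Algorithm k}
    (hA : A.SolvesFinite Δ r) {N : V → Fin k → Option V} (hN : Reciprocal N)
    (hΔ : ∀ v, (Finset.univ.filter fun c => (N v c).isSome).card ≤ Δ)
    (hex : ∃ v, (Finset.univ.filter fun c => (N v c).isSome).card = Δ) :
    ∃ o : V → Option (Fin k), (∀ v, A.output (A.runOn N r v) = some (o v)) ∧
      MatchingOutput N o := by
  have hs : Reciprocal (simpleCover N) := by
    intro p q c h
    rw [simpleCover_eq_some] at h ⊢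
    exact ⟨hN _ _ _ h.1, by rw [h.2]; simp⟩
  have hl : ∀ p c, simpleCover N p c ≠ some p := by
    intro p c h
    exact update_not_ne _ _ (simpleCover_eq_some.1 h).2.symm
  have hm : ∀ p q c d, simpleCover N p c = some q → simpleCover N p d = some q → c = d := by
    intro p q c d hc hd
    by_contra hne
    have h := (simpleCover_eq_some.1 hc).2.symm.trans (simpleCover_eq_some.1 hd).2
    simpa [hne] using congrFun h c
  set G := ColouredGraph.ofNbr _ hs hl hm
  have hG : G.neighbour = simpleCover N := ColouredGraph.neighbour_ofNbr _ hs hl hm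
  have hcard : ∀ p, G.incidentColours p = Finset.univ.filter fun c => (N p.1 c).isSome := by
    intro p
    rw [G.incidentColours_eq, hG]
    simp [simpleCover]
  have hdeg : G.MaxDegreeEq Δ := by
    refine ⟨fun p => ?_, ?_⟩
    · rw [G.encard_neighborSet, hcard]
      exact_mod_cast hΔ p.1
    · obtain ⟨v, hv⟩ := hex
      refine ⟨(v, fun _ => false), ?_⟩
      rw [G.encard_neighborSet, hcard]
      exact_mod_cast hv
  obtain ⟨o, ho, hmax⟩ := hA _ G hdeg
  have hrun : ∀ p, A.stateAfter G r p = A.runOn N r p.1 := by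
    intro p
    rw [G.stateAfter_eq_runOn, hG]
    exact A.runOn_cover Prod.fst (fun p c => by simp [simpleCover, Function.comp_def]) r p
  -- The run depends only on the base point, so the output is constant on fibres and descends to
  -- `N`.
  have hproj : ∀ p, o p = o (p.1, fun _ => false) := by
    intro p
    have h1 := ho p
    have h2 := ho (p.1, fun _ => false)
    rw [hrun] at h1 h2
    exact Option.some_inj.1 (h1.symm.trans h2)
  have hjoin : ∀ p c w, N p.1 c = some w →
      G.Joins c p (w, Function.update p.2 c (!p.2 c)) := by
    intro p c w h
    rw [← G.neighbour_eq_some, hG, simpleCover_eq_some]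
    exact ⟨h, rfl⟩
  refine ⟨fun v => o (v, fun _ => false), fun v => by rw [← ho, hrun], ?_, ?_⟩
  · intro v c h
    have hc := hmax.incident _ _ h
    rw [hcard] at hc
    obtain ⟨w, hw⟩ := Option.isSome_iff_exists.1 (Finset.mem_filter.1 hc).2
    refine ⟨w, hw, ?_⟩
    have := hmax.consistent _ _ _ h (hjoin (v, fun _ => false) c w hw)
    rwa [hproj] at this
  · intro v w c h h0
    have := hmax.maximal _ _ h0 (G.exists_joins_iff.1 ⟨c, hjoin (v, fun _ => false) c w h⟩)
    rwa [hproj] at this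

/-- A single node with loops of the colours in `T`. -/
def loopNbr (T : Finset (Fin k)) (_ : Unit) (c : Fin k) : Option Unit :=
  if c ∈ T then some () else none

theorem reciprocal_loopNbr (T : Finset (Fin k)) : Reciprocal (loopNbr T) := fun _ _ _ h => h

theorem filter_isSome_loopNbr (T : Finset (Fin k)) :
    (Finset.univ.filter fun c => (loopNbr T () c).isSome) = T := by
  ext c
  simp [loopNbr, apply_ite Option.isSome]

theorem exists_finset_card {Δ : ℕ} (h : Δ ≤ k) : ∃ T : Finset (Fin k), T.card = Δ := by
  obtain ⟨T, -, hT⟩ := Finset.exists_subset_card_eq (s := (Finset.univ : Finset (Fin k))) (n := Δ)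
    (by simpa using h)
  exact ⟨T, hT⟩

/-- The exact maximum degree is supplied by a disjoint extra node with `Δ` loops, which does not
influence the run on `N`. -/
theorem exists_matchingOutput [Finite V] {Δ r : ℕ} {A : Algorithm k} (hk : Δ ≤ k)
    (hA : A.SolvesFinite Δ r) {N : V → Fin k → Option V} (hN : Reciprocal N)
    (hΔ : ∀ v, (Finset.univ.filter fun c => (N v c).isSome).card ≤ Δ) :
    ∃ o : V → Option (Fin k), (∀ v, A.output (A.runOn N r v) = some (o v)) ∧
      MatchingOutput N o := by
  obtain ⟨T, hT⟩ := exists_finset_card hk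
  let M : V ⊕ Unit → Fin k → Option (V ⊕ Unit) :=
    Sum.elim (fun v c => (N v c).map Sum.inl) (fun u c => (loopNbr T u c).map Sum.inr)
  have hM : Reciprocal M := by
    rintro (v | v) (w | w) c h <;> simp [M] at h ⊢
    · exact hN _ _ _ h
    · exact h
  obtain ⟨o, ho, hmax⟩ := exists_matchingOutput_of_degree hA hM
    (by
      rintro (v | v)
      · simpa [M] using hΔ v
      · have := (filter_isSome_loopNbr T).symm ▸ hT
        simp only [M, Sum.elim_inr, Option.isSome_map]
        exact this.le)
    ⟨Sum.inr (), by
      have := (filter_isSome_loopNbr T).symm ▸ hT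
      simpa only [M, Sum.elim_inr, Option.isSome_map] using this⟩
  have hrun : ∀ t v, A.runOn M t (Sum.inl v) = A.runOn N t v := by
    intro t v
    exact (A.runOn_cover (N := M) (M := N) Sum.inl (fun w c => rfl) t v).symm
  refine ⟨fun v => o (Sum.inl v), fun v => by rw [← hrun, ho], ?_, ?_⟩
  · intro v c h
    obtain ⟨w, hw, how⟩ := hmax.mate _ _ h
    simp only [M, Sum.elim_inl, Option.map_eq_some_iff] at hw
    obtain ⟨w', hw', rfl⟩ := hw
    exact ⟨w', hw', how⟩
  · intro v w c h
    exact hmax.maximal _ _ c (by simp [M, h])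

/-! ### The linear lower bound: unfolding and mixing loops -/

open Classical in
/-- Cut a loop of colour `c` at `g` and a loop of colour `c` at `h`, and join `g` and `h` by an edge
of colour `c` instead. -/
noncomputable def joinNbr (N : V → Fin k → Option V) (g : V) (M : W → Fin k → Option W) (h : W)
    (c : Fin k) : V ⊕ W → Fin k → Option (V ⊕ W)
  | Sum.inl v, d => if v = g ∧ d = c then some (Sum.inr h) else (N v d).map Sum.inl
  | Sum.inr w, d => if w = h ∧ d = c then some (Sum.inl g) else (M w d).map Sum.inr

open Classical in
/-- A graph of maximum degree at most `Δ` in which every node has at least `l` loops. -/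
structure Loopy (N : V → Fin k → Option V) (Δ l : ℕ) : Prop where
  reciprocal : Reciprocal N
  degree_le : ∀ v, (Finset.univ.filter fun c => (N v c).isSome).card ≤ Δ
  le_loops : ∀ v, l ≤ (Finset.univ.filter fun c => N v c = some v).card

section join

variable {N : V → Fin k → Option V} {M : W → Fin k → Option W} {g : V} {h : W} {c : Fin k}

theorem joinNbr_inl_self : joinNbr N g M h c (Sum.inl g) c = some (Sum.inr h) := by
  simp [joinNbr]

theorem joinNbr_inr_self : joinNbr N g M h c (Sum.inr h) c = some (Sum.inl g) := by
  simp [joinNbr]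

theorem joinNbr_inl_of_not {v : V} {d : Fin k} (hv : ¬ (v = g ∧ d = c)) :
    joinNbr N g M h c (Sum.inl v) d = (N v d).map Sum.inl := by
  simp [joinNbr, hv]

theorem joinNbr_inr_of_not {w : W} {d : Fin k} (hw : ¬ (w = h ∧ d = c)) :
    joinNbr N g M h c (Sum.inr w) d = (M w d).map Sum.inr := by
  simp [joinNbr, hw]

theorem joinNbr_swap (x : V ⊕ W) (d : Fin k) :
    joinNbr M h N g c x.swap d = (joinNbr N g M h c x d).map Sum.swap := by
  rcases x with v | w
  · simp only [joinNbr, Sum.swap_inl]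
    split_ifs <;> simp [Function.comp_def]
  · simp only [joinNbr, Sum.swap_inr]
    split_ifs <;> simp [Function.comp_def]

theorem isSome_joinNbr_inl (hg : N g c = some g) (v : V) (d : Fin k) :
    (joinNbr N g M h c (Sum.inl v) d).isSome = (N v d).isSome := by
  by_cases hv : v = g ∧ d = c
  · rw [hv.1, hv.2, joinNbr_inl_self, hg]; rfl
  · rw [joinNbr_inl_of_not hv, Option.isSome_map]

theorem isSome_joinNbr_inr (hh : M h c = some h) (w : W) (d : Fin k) :
    (joinNbr N g M h c (Sum.inr w) d).isSome = (M w d).isSome := by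
  by_cases hw : w = h ∧ d = c
  · rw [hw.1, hw.2, joinNbr_inr_self, hh]; rfl
  · rw [joinNbr_inr_of_not hw, Option.isSome_map]

theorem reciprocal_joinNbr (hN : Reciprocal N) (hM : Reciprocal M) (hg : N g c = some g)
    (hh : M h c = some h) : Reciprocal (joinNbr N g M h c) := by
  rintro (v | v) w d hvw
  · by_cases hv : v = g ∧ d = c
    · obtain ⟨rfl, rfl⟩ := hv
      rw [joinNbr_inl_self, Option.some_inj] at hvw
      rw [← hvw, joinNbr_inr_self]
    · rw [joinNbr_inl_of_not hv, Option.map_eq_some_iff] at hvw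
      obtain ⟨w, hw, rfl⟩ := hvw
      have hw' := hN _ _ _ hw
      rw [joinNbr_inl_of_not, hw', Option.map_some]
      rintro ⟨rfl, rfl⟩
      rw [hg, Option.some_inj] at hw'
      exact hv ⟨hw'.symm, rfl⟩
  · by_cases hv : v = h ∧ d = c
    · obtain ⟨rfl, rfl⟩ := hv
      rw [joinNbr_inr_self, Option.some_inj] at hvw
      rw [← hvw, joinNbr_inl_self]
    · rw [joinNbr_inr_of_not hv, Option.map_eq_some_iff] at hvw
      obtain ⟨w, hw, rfl⟩ := hvw
      have hw' := hM _ _ _ hw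
      rw [joinNbr_inr_of_not, hw', Option.map_some]
      rintro ⟨rfl, rfl⟩
      rw [hh, Option.some_inj] at hw'
      exact hv ⟨hw'.symm, rfl⟩

theorem loopy_joinNbr {Δ l : ℕ} (hN : Loopy N Δ (l + 1)) (hM : Loopy M Δ (l + 1))
    (hg : N g c = some g) (hh : M h c = some h) : Loopy (joinNbr N g M h c) Δ l := by
  classical
  refine ⟨reciprocal_joinNbr hN.reciprocal hM.reciprocal hg hh, ?_, ?_⟩
  · rintro (v | v)
    · simpa only [isSome_joinNbr_inl hg] using hN.degree_le v
    · simpa only [isSome_joinNbr_inr hh] using hM.degree_le v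
  · have key : ∀ (s t : Finset (Fin k)), l + 1 ≤ s.card → s.erase c ⊆ t → l ≤ t.card := by
      intro s t hs hst
      have := Finset.card_le_card hst
      have := Finset.pred_card_le_card_erase (s := s) (a := c)
      omega
    rintro (v | v)
    · refine key _ _ (hN.le_loops v) fun d hd => ?_
      simp only [Finset.mem_erase, Finset.mem_filter, Finset.mem_univ, true_and] at hd ⊢
      rw [joinNbr_inl_of_not fun e => hd.1 e.2, hd.2, Option.map_some]
    · refine key _ _ (hM.le_loops v) fun d hd => ?_
      simp only [Finset.mem_erase, Finset.mem_filter, Finset.mem_univ, true_and] at hd ⊢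
      rw [joinNbr_inr_of_not fun e => hd.1 e.2, hd.2, Option.map_some]

/-- Joining two copies of a graph gives a double cover. -/
theorem runOn_joinNbr_self (A : Algorithm k) (hg : N g c = some g) (t : ℕ) (x : V ⊕ V) :
    A.runOn (joinNbr N g N g c) t x = A.runOn N t (Sum.elim id id x) := by
  refine A.runOn_cover (Sum.elim id id) ?_ t x
  rintro (v | v) d
  · by_cases hv : v = g ∧ d = c
    · obtain ⟨rfl, rfl⟩ := hv
      simp [joinNbr_inl_self, hg]
    · simp [joinNbr_inl_of_not hv, Function.comp_def]
  · by_cases hv : v = g ∧ d = c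
    · obtain ⟨rfl, rfl⟩ := hv
      simp [joinNbr_inr_self, hg]
    · simp [joinNbr_inr_of_not hv, Function.comp_def]

theorem runOn_joinNbr_swap (A : Algorithm k) (t : ℕ) (x : V ⊕ W) :
    A.runOn (joinNbr N g M h c) t x = A.runOn (joinNbr M h N g c) t x.swap :=
  A.runOn_cover Sum.swap joinNbr_swap t x

/-- If `g` and `h` cannot be told apart in fewer than `i` rounds, then a node cannot tell in `i`
rounds whether its graph is joined to the graph of `g` or to the graph of `h`. -/
theorem runOn_joinNbr_congr (A : Algorithm k) (hg : N g c = some g) (hh : M h c = some h) {i : ℕ}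
    (hi : ∀ j < i, A.runOn N j g = A.runOn M j h) (j : ℕ) (hj : j ≤ i) :
    (∀ v, A.runOn (joinNbr N g M h c) j (Sum.inl v) = A.runOn N j v) ∧
      ∀ w, A.runOn (joinNbr N g M h c) j (Sum.inr w) = A.runOn M j w := by
  induction j with
  | zero =>
    exact ⟨fun v => A.runOn_zero_congr (isSome_joinNbr_inl hg v),
      fun w => A.runOn_zero_congr (isSome_joinNbr_inr hh w)⟩
  | succ j ih =>
    obtain ⟨ih1, ih2⟩ := ih (by omega)
    have hgh := hi j (by omega)
    refine ⟨fun v => A.runOn_succ_congr (ih1 v) fun d => ?_,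
      fun w => A.runOn_succ_congr (ih2 w) fun d => ?_⟩
    · by_cases hv : v = g ∧ d = c
      · rw [hv.1, hv.2, joinNbr_inl_self, hg, Option.map_some, Option.map_some, ih2, hgh]
      · rw [joinNbr_inl_of_not hv, Option.map_map]
        congr 1
        exact funext ih1
    · by_cases hw : w = h ∧ d = c
      · rw [hw.1, hw.2, joinNbr_inr_self, hh, Option.map_some, Option.map_some, ih1, hgh]
      · rw [joinNbr_inr_of_not hw, Option.map_map]
        congr 1
        exact funext ih2

end join

/-- In a finite graph, two ways of matching all nodes (possibly to themselves along loops) that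
differ at one loop differ at a second loop. -/
theorem exists_second_loop [Finite V] {N : V → Fin k → Option V} {o p : V → Fin k}
    (ho : ∀ v, ∃ w, N v (o v) = some w ∧ o w = o v)
    (hp : ∀ v, ∃ w, N v (p v) = some w ∧ p w = p v) (hN : Reciprocal N) {g : V} {c : Fin k}
    (hg : N g c = some g) (hog : o g = c) (hpg : p g ≠ c) :
    ∃ v d, N v d = some v ∧ ¬ (v = g ∧ d = c) ∧ ¬ (o v = d ↔ p v = d) := by
  classical
  have := Fintype.ofFinite V
  have parity : ∀ q : V → Fin k, (∀ v, ∃ w, N v (q v) = some w ∧ q w = q v) →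
      Fintype.card V ≡ (Finset.univ.filter fun v => N v (q v) = some v).card [MOD 2] := by
    intro q hq
    choose τ hτ hqτ using hq
    -- Passing to the mate is an involution. Its fixed points are the nodes matched along loops, so
    -- their number has the parity of `V`.
    have hinv : ∀ v, τ (τ v) = v := by
      intro v
      have h1 := hτ (τ v)
      rw [hqτ, hN _ _ _ (hτ v), Option.some_inj] at h1
      exact h1.symm
    have h := Equiv.Perm.card_fixedPoints_modEq (f := (τ : Function.End V)) (p := 2) (n := 1)
      (by funext v; exact hinv v)
    convert h using 1
    rw [Fintype.card_subtype]
    congr 1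
    ext v
    simp only [Finset.mem_filter, Finset.mem_univ, true_and]
    rw [hτ v, Option.some_inj]
    rfl
  by_contra! hno
  have hpfix : g ∉ Finset.univ.filter fun v => N v (p v) = some v := by
    intro hmem
    have := (hno g (p g) (Finset.mem_filter.1 hmem).2 fun _ => hpg).2 rfl
    exact hpg (this.symm.trans hog)
  have hins : (Finset.univ.filter fun v => N v (o v) = some v) =
      insert g (Finset.univ.filter fun v => N v (p v) = some v) := by
    ext v
    simp only [Finset.mem_filter, Finset.mem_univ, true_and, Finset.mem_insert]
    by_cases hv : v = g
    · subst hv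
      simp [hog, hg]
    · simp only [hv, false_or]
      constructor
      · intro h
        rwa [(hno v (o v) h fun e => absurd e hv).1 rfl]
      · intro h
        rwa [(hno v (p v) h fun e => absurd e hv).2 rfl]
  have h1 := parity o ho
  have h2 := parity p hp
  rw [hins, Finset.card_insert_of_notMem hpfix] at h1
  have h3 := h1.symm.trans h2
  unfold Nat.ModEq at h3
  omega

/-- With at least one loop at every node, an unmatched node would be its own unmatched neighbour. -/
theorem MatchingOutput.exists_total {N : V → Fin k → Option V} {o : V → Option (Fin k)}
    (ho : MatchingOutput N o) {Δ l : ℕ} (hN : Loopy N Δ (l + 1)) :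
    ∃ p : V → Fin k, ∀ v, o v = some (p v) := by
  classical
  have : ∀ v, ∃ d, o v = some d := by
    intro v
    obtain ⟨c, hc⟩ := Finset.card_pos.1 ((Nat.succ_pos l).trans_le (hN.le_loops v))
    have hc := (Finset.mem_filter.1 hc).2
    rw [← Option.ne_none_iff_exists']
    exact fun h => ho.maximal v v c hc h h
  choose p hp using this
  exact ⟨p, hp⟩

theorem exists_total_output [Finite V] {Δ r l : ℕ} {A : Algorithm k} (hk : Δ ≤ k)
    (hA : A.SolvesFinite Δ r) {N : V → Fin k → Option V} (hN : Loopy N Δ (l + 1)) :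
    ∃ o : V → Fin k, (∀ v, A.output (A.runOn N r v) = some (some (o v))) ∧
      ∀ v, ∃ w, N v (o v) = some w ∧ o w = o v := by
  obtain ⟨o, ho, hmax⟩ := exists_matchingOutput hk hA hN.reciprocal hN.degree_le
  obtain ⟨p, hp⟩ := hmax.exists_total hN
  refine ⟨p, fun v => by rw [ho, hp], fun v => ?_⟩
  obtain ⟨w, hw, how⟩ := hmax.mate v _ (hp v)
  exact ⟨w, hw, Option.some_inj.1 ((hp w).symm.trans how)⟩

/-- There are two finite graphs with many loops and two loops in them at which the final outputs
differ, although the nodes cannot be told apart in fewer than `i` rounds. -/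
def HasSeparatedLoops (A : Algorithm k) (Δ r i l : ℕ) : Prop :=
  ∃ (V W : Type) (_ : Finite V) (_ : Finite W) (N : V → Fin k → Option V)
    (M : W → Fin k → Option W) (g : V) (h : W) (c : Fin k),
    Loopy N Δ l ∧ Loopy M Δ l ∧ N g c = some g ∧ M h c = some h ∧
    (∀ j < i, A.runOn N j g = A.runOn M j h) ∧
    ¬ (A.output (A.runOn N r g) = some (some c) ↔ A.output (A.runOn M r h) = some (some c))

/-- The new pair is the double cover of `N` by two copies joined at `g`, against the mixed graph,
both seen from the second loop of `N` at which the outputs differ. Inside the copy of `N` both look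
like `N` for `i` rounds, so the pair is good for `i + 1`. -/
theorem separatedLoops_of_joinNbr [Finite V] [Finite W] {Δ r i l : ℕ} {A : Algorithm k}
    (hk : Δ ≤ k) (hA : A.SolvesFinite Δ r) {N : V → Fin k → Option V} {M : W → Fin k → Option W}
    (hN : Loopy N Δ (l + 2)) (hM : Loopy M Δ (l + 2)) {g : V} {h : W} {c : Fin k}
    (hg : N g c = some g) (hh : M h c = some h)
    (hi : ∀ j < i, A.runOn N j g = A.runOn M j h)
    (hdiff : ¬ (A.output (A.runOn N r g) = some (some c) ↔
      A.output (A.runOn (joinNbr N g M h c) r (Sum.inl g)) = some (some c))) :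
    HasSeparatedLoops A Δ r (i + 1) (l + 1) := by
  have hGG := loopy_joinNbr (l := l + 1) hN hN hg hg
  have hGH := loopy_joinNbr (l := l + 1) hN hM hg hh
  obtain ⟨o, ho, ho'⟩ := exists_total_output hk hA hN
  obtain ⟨p, hp, hp'⟩ := exists_total_output hk hA hGH
  -- On the side of `N`, the joining edge is reinterpreted as the loop at `g` that it replaced, so
  -- the parity argument can be run in `N`.
  have hp'' : ∀ v, ∃ w, N v (p (Sum.inl v)) = some w ∧ p (Sum.inl w) = p (Sum.inl v) := by
    intro v
    obtain ⟨w, hw, hpw⟩ := hp' (Sum.inl v)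
    by_cases hv : v = g ∧ p (Sum.inl v) = c
    · refine ⟨g, ?_, ?_⟩
      · rw [hv.2, hv.1, hg]
      · rw [hv.1]
    · rw [joinNbr_inl_of_not hv, Option.map_eq_some_iff] at hw
      obtain ⟨w, hw, rfl⟩ := hw
      exact ⟨w, hw, hpw⟩
  simp only [ho, hp, Option.some_inj] at hdiff
  obtain ⟨v, d, hvd, hne, hout⟩ : ∃ v d, N v d = some v ∧ ¬ (v = g ∧ d = c) ∧
      ¬ (o v = d ↔ p (Sum.inl v) = d) := by
    by_cases hog : o g = c
    · exact exists_second_loop ho' hp'' hN.reciprocal hg hog (by tauto)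
    · obtain ⟨v, d, h1, h2, h3⟩ :=
        exists_second_loop hp'' ho' hN.reciprocal hg (c := c) (by tauto) hog
      exact ⟨v, d, h1, h2, fun e => h3 e.symm⟩
  refine ⟨V ⊕ V, V ⊕ W, inferInstance, inferInstance, joinNbr N g N g c, joinNbr N g M h c,
    Sum.inl v, Sum.inl v, d, hGG, hGH, ?_, ?_, ?_, ?_⟩
  · rw [joinNbr_inl_of_not hne, hvd, Option.map_some]
  · rw [joinNbr_inl_of_not hne, hvd, Option.map_some]
  · intro j hj
    rw [runOn_joinNbr_self A hg, (runOn_joinNbr_congr A hg hh hi j (by omega)).1]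
    rfl
  · rw [runOn_joinNbr_self A hg, hp]
    simpa only [Sum.elim_inl, id, ho, Option.some_inj] using hout

/-- The two ends of the joining edge agree on whether it is used, whereas the two original loops
disagree. So joining changes the decision at `g` or at `h`; the two cases are symmetric. -/
theorem HasSeparatedLoops.succ {Δ r i l : ℕ} {A : Algorithm k} (hk : Δ ≤ k)
    (hA : A.SolvesFinite Δ r) (H : HasSeparatedLoops A Δ r i (l + 2)) :
    HasSeparatedLoops A Δ r (i + 1) (l + 1) := by
  obtain ⟨V, W, _, _, N, M, g, h, c, hN, hM, hg, hh, hi, hdiff⟩ := H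
  obtain ⟨p, hp, hp'⟩ := exists_total_output hk hA (loopy_joinNbr (l := l + 1) hN hM hg hh)
  have hsymm : A.output (A.runOn (joinNbr N g M h c) r (Sum.inl g)) = some (some c) ↔
      A.output (A.runOn (joinNbr M h N g c) r (Sum.inl h)) = some (some c) := by
    rw [runOn_joinNbr_swap A r (Sum.inl h), Sum.swap_inl]
    simp only [hp, Option.some_inj]
    constructor
    · intro e
      obtain ⟨w, hw, hpw⟩ := hp' (Sum.inl g)
      rw [e, joinNbr_inl_self, Option.some_inj] at hw
      rw [hw, hpw, e]
    · intro e
      obtain ⟨w, hw, hpw⟩ := hp' (Sum.inr h)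
      rw [e, joinNbr_inr_self, Option.some_inj] at hw
      rw [hw, hpw, e]
  by_cases h1 : A.output (A.runOn N r g) = some (some c) ↔
      A.output (A.runOn (joinNbr N g M h c) r (Sum.inl g)) = some (some c)
  · exact separatedLoops_of_joinNbr hk hA hM hN hh hg (fun j hj => (hi j hj).symm)
      fun h2 => hdiff ((h1.trans hsymm).trans h2.symm)
  · exact separatedLoops_of_joinNbr hk hA hN hM hg hh hi h1

theorem loopy_loopNbr {T : Finset (Fin k)} {Δ l : ℕ} (hΔ : T.card ≤ Δ) (hl : l ≤ T.card) :
    Loopy (loopNbr T) Δ l := by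
  refine ⟨reciprocal_loopNbr T, fun v => ?_, fun v => ?_⟩
  · rwa [filter_isSome_loopNbr]
  · refine hl.trans (Finset.card_le_card fun c hc => ?_)
    simp [loopNbr, hc]

theorem loopNbr_eq_some {T : Finset (Fin k)} {c : Fin k} {u : Unit} :
    loopNbr T () c = some u ↔ c ∈ T := by
  simp [loopNbr]

theorem exists_output_loopNbr {Δ r : ℕ} {A : Algorithm k} (hk : Δ ≤ k) (hA : A.SolvesFinite Δ r)
    {T : Finset (Fin k)} (hΔ : T.card ≤ Δ) (hl : 0 < T.card) :
    ∃ c ∈ T, A.output (A.runOn (loopNbr T) r ()) = some (some c) := by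
  obtain ⟨o, ho, ho'⟩ := exists_total_output (l := 0) hk hA (loopy_loopNbr hΔ hl)
  obtain ⟨w, hw, -⟩ := ho' ()
  exact ⟨_, loopNbr_eq_some.1 hw, ho ()⟩

/-- Removing the loop `c` chosen by a node with loops `T` forces a choice `d ≠ c`. The loop `d` is
present in both graphs and used only in the second. -/
theorem hasSeparatedLoops_zero {Δ r : ℕ} {A : Algorithm k} (hΔ : 2 ≤ Δ) (hk : Δ ≤ k)
    (hA : A.SolvesFinite Δ r) : HasSeparatedLoops A Δ r 0 (Δ - 1) := by
  obtain ⟨T, hT⟩ := exists_finset_card hk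
  obtain ⟨c, hc, hout⟩ := exists_output_loopNbr hk hA hT.le (by omega)
  have hcard := Finset.card_erase_of_mem hc
  obtain ⟨d, hd, hout'⟩ := exists_output_loopNbr hk hA (T := T.erase c) (by omega) (by omega)
  refine ⟨Unit, Unit, inferInstance, inferInstance, loopNbr T, loopNbr (T.erase c), (), (), d,
    loopy_loopNbr hT.le (by omega), loopy_loopNbr (by omega) (by omega),
    loopNbr_eq_some.2 (Finset.mem_of_mem_erase hd), loopNbr_eq_some.2 hd, by simp, ?_⟩
  rw [hout, hout']
  simpa using (Finset.ne_of_mem_erase hd).symm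

theorem hasSeparatedLoops {Δ r : ℕ} {A : Algorithm k} (hk : Δ ≤ k)
    (hA : A.SolvesFinite Δ r) (i l : ℕ) (hil : i + l + 2 = Δ) :
    HasSeparatedLoops A Δ r i (l + 1) := by
  induction i generalizing l with
  | zero =>
    convert hasSeparatedLoops_zero (by omega) hk hA using 1
    omega
  | succ i ih => exact (ih (l + 1) (by omega)).succ hk hA

theorem Algorithm.SolvesFinite.sub_two_le {Δ r : ℕ} {A : Algorithm k} (hA : A.SolvesFinite Δ r)
    (hΔ : 2 ≤ Δ) (hk : Δ ≤ k) : Δ - 2 ≤ r := by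
  obtain ⟨V, W, _, _, N, M, g, h, c, -, -, -, -, hi, hdiff⟩ :=
    hasSeparatedLoops hk hA (Δ - 2) 0 (by omega)
  by_contra! hr
  exact hdiff (by rw [hi r hr])

/-- Without communication the output depends on the incident colours alone. A node with colours `T`
chooses `c`, while a node whose only colour is some `d ≠ c` in `T` must choose `d`; joined by an
edge of colour `d`, they contradict each other. -/
theorem Algorithm.SolvesFinite.pos {Δ r : ℕ} {A : Algorithm k} (hA : A.SolvesFinite Δ r)
    (hΔ : 2 ≤ Δ) (hk : Δ ≤ k) : 0 < r := by
  by_contra! hr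
  obtain rfl : r = 0 := by omega
  obtain ⟨T, hT⟩ := exists_finset_card hk
  obtain ⟨c, hc, hout⟩ := exists_output_loopNbr hk hA hT.le (by omega)
  have hcard := Finset.card_erase_of_mem hc
  obtain ⟨d, hd⟩ := Finset.card_pos.1 (show 0 < (T.erase c).card by omega)
  have hdT : loopNbr T () d = some () := loopNbr_eq_some.2 (Finset.mem_of_mem_erase hd)
  have hdd : loopNbr {d} () d = some () := loopNbr_eq_some.2 (by simp)
  obtain ⟨e, he, hout'⟩ := exists_output_loopNbr hk hA (T := {d}) (by simp; omega) (by simp)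
  rw [Finset.mem_singleton] at he
  subst he
  obtain ⟨o, ho, hmax⟩ := exists_matchingOutput hk hA
    (reciprocal_joinNbr (reciprocal_loopNbr T) (reciprocal_loopNbr {e}) hdT hdd)
    (by
      rintro (v | v)
      · simp only [isSome_joinNbr_inl hdT]
        rw [filter_isSome_loopNbr]; omega
      · simp only [isSome_joinNbr_inr hdd]
        rw [filter_isSome_loopNbr]; simp; omega)
  have h1 := ho (Sum.inl ())
  have h2 := ho (Sum.inr ())
  rw [A.runOn_zero_congr (isSome_joinNbr_inl hdT ()), hout, Option.some_inj] at h1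
  rw [A.runOn_zero_congr (isSome_joinNbr_inr hdd ()), hout', Option.some_inj] at h2
  obtain ⟨w, hw, how⟩ := hmax.mate _ _ h2.symm
  rw [joinNbr_inr_self, Option.some_inj] at hw
  rw [← hw, ← h1, Option.some_inj] at how
  exact Finset.ne_of_mem_erase hd how.symm

/-! ### Iterated logarithms and towers -/

/-- The tower of `n` twos. -/
def tower (n : ℕ) : ℕ := (fun m => 2 ^ m)^[n] 1

theorem tower_zero : tower 0 = 1 := rfl

theorem tower_succ (n : ℕ) : tower (n + 1) = 2 ^ tower n :=
  Function.iterate_succ_apply' _ _ _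

theorem monotone_two_pow : Monotone fun m : ℕ => 2 ^ m := fun _ _ h =>
  Nat.pow_le_pow_right (by norm_num) h

theorem one_le_tower (n : ℕ) : 1 ≤ tower n := by
  cases n with
  | zero => exact le_rfl
  | succ n => rw [tower_succ]; exact Nat.one_le_two_pow

theorem exists_iterate_logb_le {n : ℕ} {x : ℝ} (hx : x ≤ tower n) :
    ∃ m ≤ n, (Real.logb 2)^[m] x ≤ 1 := by
  induction n generalizing x with
  | zero => exact ⟨0, le_rfl, by simpa [tower_zero] using hx⟩
  | succ n ih =>
    by_cases h1 : x ≤ 1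
    · exact ⟨0, by omega, h1⟩
    · have hlog : Real.logb 2 x ≤ tower n := by
        rw [Real.logb_le_iff_le_rpow (by norm_num) (by linarith), Real.rpow_natCast]
        rw [tower_succ] at hx
        exact_mod_cast hx
      obtain ⟨m, hm, hle⟩ := ih hlog
      exact ⟨m + 1, by omega, hle⟩

theorem logStar_le {n : ℕ} {x : ℝ} (hx : x ≤ tower n) : logStar x ≤ n := by
  obtain ⟨m, hm, hle⟩ := exists_iterate_logb_le hx
  exact (Nat.sInf_le hle).trans hm

theorem le_tower_of_iterate_logb {n : ℕ} {x : ℝ} (hx : (Real.logb 2)^[n] x ≤ 1)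
    (hlt : ∀ m < n, 1 < (Real.logb 2)^[m] x) : x ≤ tower n := by
  induction n generalizing x with
  | zero => simpa [tower_zero] using hx
  | succ n ih =>
    have h1 : 1 < x := hlt 0 (by omega)
    have := ih (x := Real.logb 2 x) hx fun m hm => hlt (m + 1) (by omega)
    rw [Real.logb_le_iff_le_rpow (by norm_num) (by linarith), Real.rpow_natCast] at this
    rw [tower_succ]
    exact_mod_cast this

theorem le_tower_self (n : ℕ) : n ≤ tower n := by
  induction n with
  | zero => omega
  | succ n ih => rw [tower_succ]; exact Nat.lt_two_pow_self.trans_le (monotone_two_pow ih)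

theorem le_tower_logStar (n : ℕ) : n ≤ tower (logStar n) := by
  have hne : {m : ℕ | (Real.logb 2)^[m] (n : ℝ) ≤ 1}.Nonempty := by
    obtain ⟨m, -, hm⟩ := exists_iterate_logb_le (n := n) (x := n) (by exact_mod_cast le_tower_self n)
    exact ⟨m, hm⟩
  have := le_tower_of_iterate_logb (n := logStar n) (x := n) (Nat.sInf_mem hne)
    fun m hm => not_le.1 fun h => Nat.notMem_of_lt_sInf hm h
  exact_mod_cast this

/-! ### The lower bound `Ω(log* k)`: cycles and shift graphs -/

/-- Linial's lower bound for colouring the shift graph: vertices are increasing sequences of length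
`n + 1`, adjacent if they overlap in `n` places. -/
theorem le_iterate_two_pow_of_shift_colouring (n : ℕ) {α : Type} [Fintype α] (f : List (Fin k) → α)
    (hf : ∀ a m b, m.length = n → (a :: (m ++ [b])).Pairwise (· < ·) → f (a :: m) ≠ f (m ++ [b])) :
    k ≤ (fun m => 2 ^ m)^[n] (Fintype.card α) := by
  induction n generalizing α with
  | zero =>
    have hinj : Function.Injective fun a : Fin k => f [a] := by
      intro a b hab
      by_contra hne
      rcases lt_or_gt_of_ne hne with h | h
      · exact hf a [] b rfl (by simpa using h) hab
      · exact hf b [] a rfl (by simpa using h) hab.symm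
    simpa using Fintype.card_le_of_injective _ hinj
  | succ n ih =>
    -- A shorter list gets the set of colours of its extensions by a smaller first entry. If `a ::
    -- m` and `m ++ [b]` had the same set, the colour of `a :: (m ++ [b])` would also be that of
    -- some `z :: a :: m`, its neighbour in the shift graph.
    have := ih (α := Set α) (fun l => {y | ∃ z, (z :: l).Pairwise (· < ·) ∧ f (z :: l) = y}) ?_
    · rwa [Fintype.card_set] at this
    · intro a m b hm hsort heq
      have hmem : f (a :: (m ++ [b])) ∈
          {y | ∃ z, (z :: (m ++ [b])).Pairwise (· < ·) ∧ f (z :: (m ++ [b])) = y} :=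
        ⟨a, hsort, rfl⟩
      rw [← heq] at hmem
      obtain ⟨z, hz, hfz⟩ := hmem
      refine hf z (a :: m) b (by simp [hm]) ?_ hfz
      have hza : z < a := (List.pairwise_cons.1 hz).1 a (by simp)
      refine List.pairwise_cons.2 ⟨?_, hsort⟩
      intro c hc
      rcases List.mem_cons.1 hc with rfl | hc
      · exact hza
      · exact hza.trans ((List.pairwise_cons.1 hsort).1 c hc)

/-- The cycle on `ℤ/n` in which the edge between `v` and `v + 1` has colour `x v`. -/
def cycleNbr {n : ℕ} (x : ZMod n → Fin k) (v : ZMod n) (c : Fin k) : Option (ZMod n) :=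
  if x v = c then some (v + 1) else if x (v - 1) = c then some (v - 1) else none

theorem cycleNbr_succ {n : ℕ} (x : ZMod n → Fin k) (v : ZMod n) :
    cycleNbr x v (x v) = some (v + 1) := by
  simp [cycleNbr]

theorem eq_of_cycleNbr_eq_some {n : ℕ} {x : ZMod n → Fin k} {v w : ZMod n} {c : Fin k}
    (h : cycleNbr x v c = some w) : c = x v ∧ w = v + 1 ∨ c = x (v - 1) ∧ w = v - 1 := by
  unfold cycleNbr at h
  split_ifs at h with h1 h2
  · exact Or.inl ⟨h1.symm, (Option.some_inj.1 h).symm⟩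
  · exact Or.inr ⟨h2.symm, (Option.some_inj.1 h).symm⟩

theorem reciprocal_cycleNbr {n : ℕ} {x : ZMod n → Fin k} (hx : ∀ v, x v ≠ x (v + 1)) :
    Reciprocal (cycleNbr x) := by
  intro v w c h
  rcases eq_of_cycleNbr_eq_some h with ⟨rfl, rfl⟩ | ⟨rfl, rfl⟩
  · simp [cycleNbr, (hx v).symm]
  · simp [cycleNbr]

theorem degree_cycleNbr_le {n : ℕ} (x : ZMod n → Fin k) (v : ZMod n) :
    (Finset.univ.filter fun c => (cycleNbr x v c).isSome).card ≤ 2 := by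
  refine (Finset.card_le_card (t := {x v, x (v - 1)}) fun c hc => ?_).trans Finset.card_le_two
  obtain ⟨w, hw⟩ := Option.isSome_iff_exists.1 (Finset.mem_filter.1 hc).2
  rcases eq_of_cycleNbr_eq_some hw with h | h <;> simp [h.1]

/-- In `t` rounds a node learns about `t + 1` edges on either side. The lengths of the cycles are
irrelevant, so a window may be closed up to a shorter cycle. -/
theorem runOn_cycleNbr_congr (A : Algorithm k) {n n' : ℕ} {x : ZMod n → Fin k}
    {x' : ZMod n' → Fin k} (t : ℕ) (u : ZMod n) (u' : ZMod n')
    (h : ∀ j < 2 * t + 2, x (u + (j : ℕ)) = x' (u' + (j : ℕ))) :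
    A.runOn (cycleNbr x) t (u + (t + 1 : ℕ)) = A.runOn (cycleNbr x') t (u' + (t + 1 : ℕ)) := by
  induction t generalizing u u' with
  | zero =>
    have h0 := h 0 (by omega)
    have h1 := h 1 (by omega)
    refine A.runOn_zero_congr fun c => ?_
    simp only [Nat.cast_zero, add_zero, Nat.cast_one] at h0 h1
    simp only [cycleNbr, zero_add, Nat.cast_one, add_sub_cancel_right, h0, h1]
    split_ifs <;> rfl
  | succ t ih =>
    have e1 : ∀ {m : ℕ} (u : ZMod m), u + (t + 1 + 1 : ℕ) = (u + 1) + (t + 1 : ℕ) := by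
      intro m u; push_cast; ring
    have e2 : ∀ {m : ℕ} (u : ZMod m), u + (t + 1 + 1 : ℕ) + 1 = (u + 2) + (t + 1 : ℕ) := by
      intro m u; push_cast; ring
    have e3 : ∀ {m : ℕ} (u : ZMod m), u + (t + 1 + 1 : ℕ) - 1 = u + (t + 1 : ℕ) := by
      intro m u; push_cast; ring
    have hj : ∀ s : ℕ, s ≤ 2 → ∀ j < 2 * t + 2,
        x (u + (s : ℕ) + (j : ℕ)) = x' (u' + (s : ℕ) + (j : ℕ)) := by
      intro s hs j hj
      have := h (s + j) (by omega)
      push_cast at this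
      simpa only [add_assoc] using this
    have i0 := ih u u' fun j hj' => h j (by omega)
    have i1 := ih (u + 1) (u' + 1) (by simpa using hj 1 (by omega))
    have i2 := ih (u + 2) (u' + 2) (by simpa using hj 2 (by omega))
    have x1 := h (t + 1 + 1) (by omega)
    have x0 := h (t + 1) (by omega)
    refine A.runOn_succ_congr ?_ fun c => ?_
    · rw [e1, e1]; exact i1
    · unfold cycleNbr
      rw [x1, e3, e3, x0, e2, e2]
      split_ifs
      · exact congrArg some i2
      · exact congrArg some i0
      · rfl

/-- The colours of the edges of the cycle given by a list. -/
def listColour (l : List (Fin k)) (d : Fin k) (v : ZMod l.length) : Fin k := l.getD v.val d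

theorem listColour_natCast (l : List (Fin k)) (d : Fin k) {j : ℕ} (hj : j < l.length) :
    listColour l d (j : ZMod l.length) = l[j] := by
  rw [listColour, ZMod.val_natCast_of_lt hj, List.getD_eq_getElem _ _ hj]

theorem listColour_ne {l : List (Fin k)} (d : Fin k) (hl : l.Nodup) (h2 : 2 ≤ l.length)
    (v : ZMod l.length) : listColour l d v ≠ listColour l d (v + 1) := by
  have : NeZero l.length := ⟨by omega⟩
  have : Fact (1 < l.length) := ⟨h2⟩
  intro h
  rw [listColour, listColour, List.getD_eq_getElem _ _ (ZMod.val_lt _),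
    List.getD_eq_getElem _ _ (ZMod.val_lt _), hl.getElem_inj_iff] at h
  have := ZMod.val_injective _ h
  simp at this

open Classical in
/-- How a node that announces `o` is matched in an oriented cycle: along the next edge, which has
colour `c` (`0`), along the previous edge (`1`), or not at all (`2`). -/
noncomputable def direction (c : Fin k) (o : Option (Option (Fin k))) : Fin 3 :=
  if o = some (some c) then 0 else if o = some none then 2 else 1

/-- Two consecutive nodes cannot both be matched forwards, since the second would be matched along
both its edges; likewise backwards; and both unmatched contradicts maximality. -/
theorem MatchingOutput.direction_ne {n : ℕ} {x : ZMod n → Fin k} (hx : ∀ v, x v ≠ x (v + 1))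
    {o : ZMod n → Option (Fin k)} (ho : MatchingOutput (cycleNbr x) o) (v : ZMod n) :
    direction (x v) (some (o v)) ≠ direction (x (v + 1)) (some (o (v + 1))) := by
  have h1 : o v = some (x v) → o (v + 1) = some (x v) := by
    intro h
    obtain ⟨w, hw, how⟩ := ho.mate _ _ h
    rw [cycleNbr_succ, Option.some_inj] at hw
    rwa [hw]
  have h2 := ho.maximal v (v + 1) (x v) (cycleNbr_succ x v)
  have h3 : ∀ c, o (v + 1) = some c → c ≠ x (v + 1) → o v = some (x v) := by
    intro c hc hne
    obtain ⟨w, hw, how⟩ := ho.mate _ _ hc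
    rcases eq_of_cycleNbr_eq_some hw with ⟨e, -⟩ | ⟨e, e'⟩
    · exact absurd e hne
    · rw [add_sub_cancel_right] at e e'
      rw [← e', how, e, e']
  unfold direction
  simp only [Option.some_inj]
  rcases hv : o v with _ | c <;> rcases hw : o (v + 1) with _ | d
  · exact absurd hw (h2 hv)
  · by_cases hd : d = x (v + 1)
    · simp [hd]
    · simp [hd]
  · by_cases hc : c = x v
    · simp [hc]
    · simp [hc]
  · by_cases hc : c = x v
    · have := h1 (by rw [hv, hc])
      rw [hw, Option.some_inj] at this
      simp [hc, this, hx v]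
    · have hd : d = x (v + 1) := by
        by_contra hd
        exact hc (Option.some_inj.1 (hv.symm.trans (h3 d hw hd)))
      simp [hc, hd]

theorem Algorithm.SolvesFinite.le_tower {Δ r : ℕ} {A : Algorithm k} (hA : A.SolvesFinite Δ r)
    (hΔ : 2 ≤ Δ) (hk : Δ ≤ k) : k ≤ tower (2 * r + 3) := by
  let d : Fin k := ⟨0, by omega⟩
  -- The window itself, closed to a cycle, serves to simulate the node `r + 1`, whose `r`-round view
  -- is exactly these `2r + 2` edges. Its next edge is entry `r + 1`.
  let f : List (Fin k) → Fin 3 := fun l =>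
    direction (l.getD (r + 1) d) (A.output (A.runOn (cycleNbr (listColour l d)) r (r + 1 : ℕ)))
  have hf := le_iterate_two_pow_of_shift_colouring (2 * r + 1) f ?_
  · refine hf.trans ?_
    -- The three directions fit under `tower 2 = 4`, and `2r + 1` further exponentials give height
    -- `2r + 3`.
    have : Fintype.card (Fin 3) ≤ (fun m => 2 ^ m)^[2] 1 := by simp
    refine (monotone_two_pow.iterate _ this).trans_eq ?_
    rw [← Function.iterate_add_apply]
    rfl
  · intro a m b hm hsort
    set l := a :: (m ++ [b]) with hl
    have hlen : l.length = 2 * r + 3 := by simp [hl, hm]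
    have hx := listColour_ne d hsort.nodup (by omega)
    obtain ⟨o, ho, hmax⟩ := exists_matchingOutput hk hA (reciprocal_cycleNbr hx)
      fun v => (degree_cycleNbr_le _ v).trans hΔ
    have : NeZero l.length := ⟨by omega⟩
    have h1 : f (a :: m) = direction (listColour l d (r + 1 : ℕ)) (some (o (r + 1 : ℕ))) := by
      have hrun := runOn_cycleNbr_congr A (x := listColour (a :: m) d) (x' := listColour l d) r 0 0
        (by
          intro j hj
          rw [zero_add, zero_add, listColour_natCast _ _ (by simp; omega),
            listColour_natCast _ _ (by omega)]
          simp only [hl, ← List.cons_append]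
          rw [List.getElem_append_left])
      rw [zero_add, zero_add] at hrun
      replace hrun := (congrArg A.output hrun).trans (ho _)
      simp only [f, hrun]
      congr 1
      rw [listColour_natCast _ _ (by omega), List.getD_eq_getElem _ _ (by simp; omega)]
      simp only [hl, ← List.cons_append]
      rw [List.getElem_append_left]
    have h2 : f (m ++ [b]) = direction (listColour l d ((r + 1 : ℕ) + 1))
        (some (o ((r + 1 : ℕ) + 1))) := by
      have hrun := runOn_cycleNbr_congr A (x := listColour (m ++ [b]) d) (x' := listColour l d)
        r 0 1
        (by
          intro j hj
          have e : (1 + (j : ℕ) : ZMod l.length) = (j + 1 : ℕ) := by push_cast; ring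
          rw [zero_add, e, listColour_natCast _ _ (by simp; omega),
            listColour_natCast _ _ (by omega)]
          simp only [hl, List.getElem_cons_succ])
      rw [zero_add, add_comm 1] at hrun
      replace hrun := (congrArg A.output hrun).trans (ho _)
      simp only [f, hrun]
      congr 1
      have e : ((r + 1 : ℕ) + 1 : ZMod l.length) = (r + 1 + 1 : ℕ) := by push_cast; ring
      rw [e, listColour_natCast _ _ (by omega), List.getD_eq_getElem _ _ (by simp; omega)]
      simp only [hl, List.getElem_cons_succ]
    rw [h1, h2]
    exact hmax.direction_ne hx _

/-! ### The algorithm -/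

/-- One step of the Cole–Vishkin colour reduction: the position and the value of the first binary
digit in which `a` differs from `b`. -/
noncomputable def coleVishkin (a b : ℕ) : ℕ :=
  open Classical in
  if h : ∃ i, a.testBit i ≠ b.testBit i then 2 * Nat.find h + (a.testBit (Nat.find h)).toNat
  -- The default acts as if the labels differed in digit 0. It serves a node without an `i`-th edge,
  -- which compares with itself.
  else (a.testBit 0).toNat

/-- Equal new labels would name the same position and the same digit there, but `a` and `b` differ
at the position named by the label of `a`. What `b` is compared with does not matter. -/
theorem coleVishkin_ne {a b : ℕ} (hab : a ≠ b) (c : ℕ) : coleVishkin a b ≠ coleVishkin b c := by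
  classical
  have h : ∃ i, a.testBit i ≠ b.testBit i := by
    by_contra! h
    exact hab (Nat.eq_of_testBit_eq h)
  have hb : ∃ j, coleVishkin b c = 2 * j + (b.testBit j).toNat := by
    unfold coleVishkin
    split_ifs with h'
    · exact ⟨_, rfl⟩
    · exact ⟨0, by simp⟩
  obtain ⟨j, hj⟩ := hb
  have hs := Nat.find_spec h
  rw [hj, coleVishkin, dif_pos h]
  intro e
  have l1 := Bool.toNat_le (a.testBit (Nat.find h))
  have l2 := Bool.toNat_le (b.testBit j)
  have hij : Nat.find h = j := by omega
  have hbits : (a.testBit (Nat.find h)).toNat = (b.testBit j).toNat := by omega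
  rw [← hij] at hbits
  cases h1 : a.testBit (Nat.find h) <;> cases h2 : b.testBit (Nat.find h) <;> simp_all

theorem coleVishkin_lt {a b n : ℕ} (ha : a < 2 ^ n) (hb : b < 2 ^ n) (hn : 0 < n) :
    coleVishkin a b < 2 * n := by
  classical
  unfold coleVishkin
  split_ifs with h
  · have hlt : Nat.find h < n := by
      by_contra! hle
      have hpow := monotone_two_pow hle
      exact Nat.find_spec h ((Nat.testBit_lt_two_pow (ha.trans_le hpow)).trans
        (Nat.testBit_lt_two_pow (hb.trans_le hpow)).symm)
    have := Bool.toNat_le (a.testBit (Nat.find h))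
    omega
  · have := Bool.toNat_le (a.testBit 0)
    omega

/-- Since `4 * tower (n + 1) = 2 ^ (2 + tower n)`, one step leads below `2 * (2 + tower n)`, which
is at most `4 * tower n` once `tower n ≥ 2`. The `max 1` stops the descent at the stable bound 8. -/
theorem coleVishkin_lt_tower {a b s : ℕ} (ha : a < 4 * tower (max 1 s))
    (hb : b < 4 * tower (max 1 s)) : coleVishkin a b < 4 * tower (max 1 (s - 1)) := by
  have key : ∀ n, 4 * tower (n + 1) = 2 ^ (2 + tower n) := by
    intro n; rw [tower_succ, pow_add]; norm_num
  have h1 : tower 1 = 2 := rfl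
  rcases s with _ | _ | s
  · have := coleVishkin_lt (n := 3) (by simpa [h1] using ha) (by simpa [h1] using hb) (by norm_num)
    simp [h1]; omega
  · have := coleVishkin_lt (n := 3) (by simpa [h1] using ha) (by simpa [h1] using hb) (by norm_num)
    simp [h1]; omega
  · rw [show max 1 (s + 1 + 1) = s + 1 + 1 by omega, key] at ha hb
    have := coleVishkin_lt ha hb (by omega)
    rw [show max 1 (s + 1 + 1 - 1) = s + 1 by omega]
    have h2 : 2 ≤ tower (s + 1) := by
      rw [tower_succ]
      exact monotone_two_pow (one_le_tower s)
    omega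

/-! ### Ports and the state machine -/

/-- The `i`-th smallest colour in `S`. -/
def port (S : Finset (Fin k)) (i : ℕ) : Option (Fin k) := (S.sort (· ≤ ·))[i]?

theorem exists_port_eq {S : Finset (Fin k)} {c : Fin k} (hc : c ∈ S) :
    ∃ i < S.card, port S i = some c := by
  obtain ⟨i, hi, h⟩ := List.mem_iff_getElem.1 ((Finset.mem_sort (· ≤ ·)).2 hc)
  exact ⟨i, by simpa using hi, by rw [port, List.getElem?_eq_getElem hi, h]⟩

/-- The state of a node in the algorithm: the number of rounds so far, the colours of the incident
edges, for every `i` a label for the graph formed by the `i`-th edges of all nodes, and the colour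
of the edge along which the node has been matched. -/
structure MatchState (k : ℕ) where
  time : ℕ
  colours : Finset (Fin k)
  label : ℕ → ℕ
  mate : Option (Fin k)

namespace MatchState

def start (S : Finset (Fin k)) : MatchState k where
  time := 0
  colours := S
  -- The default `k` differs from every colour, so nodes without an `i`-th edge are told apart from
  -- those pointing to them.
  label i := (port S i).elim k fun c => c
  mate := none

/-- The labels are reduced by comparing with the neighbour along the `i`-th edge. -/
noncomputable def relabel (s : MatchState k) (msg : Fin k → Option (MatchState k)) (i : ℕ) : ℕ :=
  coleVishkin (s.label i) (((port s.colours i).bind msg).elim (s.label i) fun u => u.label i)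

/-- In phase `(i, j)` a free node with state `s` has a proposal along its edge of colour `c`: this
is the `i`-th edge of another free node, with label `j`; for `j = 8` it is the `i`-th edge of both
nodes. -/
def Proposal (i j : ℕ) (s : MatchState k) (msg : Fin k → Option (MatchState k)) (c : Fin k) :
    Prop :=
  ∃ u, msg c = some u ∧ u.mate = none ∧ port u.colours i = some c ∧
    if j = 8 then port s.colours i = some c else port s.colours i ≠ some c ∧ u.label i = j

open Classical in
noncomputable def pick (p : Fin k → Prop) : Option (Fin k) :=
  if h : ∃ c, p c then some h.choose else none

theorem pick_spec {p : Fin k → Prop} {c : Fin k} (h : pick p = some c) : p c := by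
  unfold pick at h
  split_ifs at h with hp
  rw [← Option.some_inj.1 h]
  exact hp.choose_spec

theorem pick_ne_none {p : Fin k → Prop} {c : Fin k} (h : p c) : pick p ≠ none := by
  unfold pick
  rw [dif_pos ⟨c, h⟩]
  exact Option.some_ne_none _

/-- A free node that has a proposal accepts one of them. -/
noncomputable def accept (i j : ℕ) (s : MatchState k) (msg : Fin k → Option (MatchState k)) :
    Option (Fin k) :=
  s.mate.or (pick (s.Proposal i j msg))

/-- A free node that has been accepted by a neighbour is matched to it. -/
noncomputable def confirm (s : MatchState k) (msg : Fin k → Option (MatchState k)) :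
    Option (Fin k) :=
  s.mate.or (pick fun c => ∃ u, msg c = some u ∧ u.mate = some c)

/-- `R` rounds of colour reduction, followed by two rounds for every phase `(i, j)`. -/
noncomputable def next (R : ℕ) (s : MatchState k) (msg : Fin k → Option (MatchState k)) :
    MatchState k :=
  if s.time < R then { s with time := s.time + 1, label := s.relabel msg }
  else if (s.time - R) % 2 = 0 then
    { s with
      time := s.time + 1
      mate := s.accept ((s.time - R) / 2 / 9) ((s.time - R) / 2 % 9) msg }
  else { s with time := s.time + 1, mate := s.confirm msg }

theorem time_next (R : ℕ) (s : MatchState k) (msg : Fin k → Option (MatchState k)) :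
    (s.next R msg).time = s.time + 1 := by
  unfold next
  split_ifs <;> rfl

theorem colours_next (R : ℕ) (s : MatchState k) (msg : Fin k → Option (MatchState k)) :
    (s.next R msg).colours = s.colours := by
  unfold next
  split_ifs <;> rfl

/-- The messages at a node, if all nodes send their states. -/
def received (nbr : V → Fin k → Option V) (s : V → MatchState k) (v : V) (c : Fin k) :
    Option (MatchState k) :=
  (nbr v c).map s

end MatchState

/-! ### Correctness of a single phase -/

/-- The outputs form a matching. -/
def Matched (nbr : V → Fin k → Option V) (m : V → Option (Fin k)) : Prop :=
  ∀ v c, m v = some c → ∃ w, nbr v c = some w ∧ m w = some c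

/-- Two free nodes that compete in phase `(i, j)` along the edge of colour `c`. -/
def PhaseEdge (nbr : V → Fin k → Option V) (S : V → Finset (Fin k)) (x : V → ℕ → ℕ) (i j : ℕ)
    (w v : V) (c : Fin k) : Prop :=
  nbr w c = some v ∧ port (S v) i = some c ∧
    if j = 8 then port (S w) i = some c else port (S w) i ≠ some c ∧ x v i = j

/-- For `j < 8` a proposer cannot accept anything in the same phase, as another proposer pointing to
it would have the same label; and it proposes along one edge only, so its sole possible confirmation
is along that edge. For `j = 8` both ends of the edge propose and accept each other. -/
theorem matched_of_phase {nbr : V → Fin k → Option V} (hs : Reciprocal nbr)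
    {S : V → Finset (Fin k)} {x : V → ℕ → ℕ}
    (hx : ∀ v w i c, port (S v) i = some c → nbr v c = some w → port (S w) i ≠ some c →
      x v i ≠ x w i) {i j : ℕ} {m m' m'' : V → Option (Fin k)} (hm : Matched nbr m)
    (hacc : ∀ w, m' w = (m w).or
      (MatchState.pick fun c => ∃ v, PhaseEdge nbr S x i j w v c ∧ m v = none))
    (hconf : ∀ v, m'' v = (m' v).or
      (MatchState.pick fun c => ∃ w, nbr v c = some w ∧ m' w = some c)) :
    Matched nbr m'' := by
  have hfix : ∀ v c, m v = some c → m'' v = some c := by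
    intro v c h
    simp [hconf, hacc, h]
  have hfix' : ∀ v c, m' v = some c → m'' v = some c := by
    intro v c h
    simp [hconf, h]
  have hpick : ∀ w c, m w = none → m' w = some c → ∃ v, PhaseEdge nbr S x i j w v c ∧
      m v = none := by
    intro w c h h'
    rw [hacc, h, Option.none_or] at h'
    exact MatchState.pick_spec (p := fun c => ∃ v, PhaseEdge nbr S x i j w v c ∧ m v = none) h'
  intro w c hc
  rcases hm' : m' w with _ | d
  · rw [hconf, hm', Option.none_or] at hc
    obtain ⟨v, hv, hmv⟩ := MatchState.pick_spec hc
    exact ⟨v, hv, hfix' _ _ hmv⟩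
  · obtain rfl : d = c := by
      rw [hfix' _ _ hm'] at hc
      exact Option.some_inj.1 hc
    rcases hmw : m w with _ | e
    · obtain ⟨v, ⟨hwv, hpv, hcase⟩, hmv⟩ := hpick w d hmw hm'
      refine ⟨v, hwv, ?_⟩
      have hvw := hs _ _ _ hwv
      by_cases hj : j = 8
      · rw [if_pos hj] at hcase
        have hne : m' v ≠ none := by
          rw [hacc, hmv, Option.none_or]
          exact MatchState.pick_ne_none (c := d) ⟨w, ⟨hvw, hcase, by rwa [if_pos hj]⟩, hmw⟩
        obtain ⟨c', hc'⟩ := Option.ne_none_iff_exists'.1 hne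
        obtain ⟨u, ⟨-, -, hu⟩, -⟩ := hpick v c' hmv hc'
        rw [if_pos hj, hpv, Option.some_inj] at hu
        rw [hfix' _ _ hc', hu]
      · rw [if_neg hj] at hcase
        have hnone : m' v = none := by
          by_contra hne
          obtain ⟨c', hc'⟩ := Option.ne_none_iff_exists'.1 hne
          obtain ⟨u, ⟨hvu, hpu, hu⟩, -⟩ := hpick v c' hmv hc'
          rw [if_neg hj] at hu
          exact hx u v i c' hpu (hs _ _ _ hvu) hu.1 (hu.2.trans hcase.2.symm)
        rw [hconf, hnone, Option.none_or]
        have hne := MatchState.pick_ne_none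
          (p := fun c => ∃ u, nbr v c = some u ∧ m' u = some c) (c := d) ⟨w, hvw, hm'⟩
        obtain ⟨c', hc'⟩ := Option.ne_none_iff_exists'.1 hne
        obtain ⟨u, hu, hmu⟩ := MatchState.pick_spec hc'
        rcases hmu' : m u with _ | e
        · obtain ⟨y, ⟨huy, hpy, -⟩, -⟩ := hpick u c' hmu' hmu
          rw [hs _ _ _ hu, Option.some_inj] at huy
          rw [← huy, hpv, Option.some_inj] at hpy
          rw [hc', hpy]
        -- A neighbour matched to `v` before the phase would mean that `v` was not free.
        · obtain rfl : e = c' := by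
            rw [hacc, hmu', Option.some_or] at hmu
            exact Option.some_inj.1 hmu
          obtain ⟨y, huy, hmy⟩ := hm _ _ hmu'
          rw [hs _ _ _ hu, Option.some_inj] at huy
          rw [← huy, hmv] at hmy
          cases hmy
    · obtain rfl : e = d := by
        rw [hacc, hmw, Option.some_or] at hm'
        exact Option.some_inj.1 hm'
      obtain ⟨v, hv, hmv⟩ := hm _ _ hmw
      exact ⟨v, hv, hfix _ _ hmv⟩

/-! ### Labels and matchings along an execution -/

/-- An execution of the state machine on a graph. -/
structure Execution (R : ℕ) (nbr : V → Fin k → Option V) (s : ℕ → V → MatchState k) (r : ℕ) :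
    Prop where
  start : ∀ v, s 0 v = MatchState.start (Finset.univ.filter fun c => (nbr v c).isSome)
  next : ∀ t < r, ∀ v, s (t + 1) v = (s t v).next R (MatchState.received nbr (s t) v)

namespace Execution

variable {R r : ℕ} {nbr : V → Fin k → Option V} {s : ℕ → V → MatchState k}

theorem time_eq (E : Execution R nbr s r) {t : ℕ} (ht : t ≤ r) (v : V) : (s t v).time = t := by
  induction t with
  | zero => rw [E.start]; rfl
  | succ t ih =>
    rw [E.next t (by omega), MatchState.time_next, ih (by omega)]

theorem colours_eq (E : Execution R nbr s r) {t : ℕ} (ht : t ≤ r) (v : V) :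
    (s t v).colours = Finset.univ.filter fun c => (nbr v c).isSome := by
  induction t with
  | zero => rw [E.start]; rfl
  | succ t ih =>
    rw [E.next t (by omega), MatchState.colours_next, ih (by omega)]

theorem label_succ (E : Execution R nbr s r) {t : ℕ} (ht : t < r) (htR : t < R) (v : V) :
    (s (t + 1) v).label = (s t v).relabel (MatchState.received nbr (s t) v) := by
  rw [E.next t ht, MatchState.next, E.time_eq ht.le, if_pos htR]

theorem label_eq (E : Execution R nbr s r) {t : ℕ} (ht : t ≤ r) (htR : R ≤ t) (v : V) :
    (s t v).label = (s R v).label := by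
  induction t, htR using Nat.le_induction with
  | base => rfl
  | succ t htR ih =>
    rw [← ih (by omega), E.next t (by omega), MatchState.next, E.time_eq (by omega),
      if_neg (by omega)]
    split_ifs <;> rfl

theorem mate_eq_none (E : Execution R nbr s r) {t : ℕ} (ht : t ≤ r) (htR : t ≤ R) (v : V) :
    (s t v).mate = none := by
  induction t with
  | zero => rw [E.start]; rfl
  | succ t ih =>
    rw [E.next t (by omega), MatchState.next, E.time_eq (by omega), if_pos (by omega)]
    exact ih (by omega) (by omega)

theorem mate_accept (E : Execution R nbr s r) {q : ℕ} (hq : R + 2 * q < r) (v : V) :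
    (s (R + 2 * q + 1) v).mate = (s (R + 2 * q) v).accept (q / 9) (q % 9)
      (MatchState.received nbr (s (R + 2 * q)) v) := by
  rw [E.next _ hq, MatchState.next, E.time_eq hq.le, if_neg (by omega), if_pos (by omega)]
  simp only [Nat.add_sub_cancel_left]
  rw [Nat.mul_div_cancel_left _ (by norm_num)]

theorem mate_confirm (E : Execution R nbr s r) {q : ℕ} (hq : R + 2 * q + 1 < r) (v : V) :
    (s (R + 2 * q + 2) v).mate = (s (R + 2 * q + 1) v).confirm
      (MatchState.received nbr (s (R + 2 * q + 1)) v) := by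
  rw [E.next _ hq, MatchState.next, E.time_eq hq.le, if_neg (by omega), if_neg (by omega)]

/-- Initially the labels are the colours of two different `i`-th edges, or `k` if `w` has none;
Cole–Vishkin steps preserve the difference along the pointer from `v` to `w`. -/
theorem label_ne (E : Execution R nbr s r) {t : ℕ} (ht : t ≤ r) (htR : t ≤ R) {v w : V} {i : ℕ}
    {c : Fin k} (hp : port (Finset.univ.filter fun c => (nbr v c).isSome) i = some c)
    (hvw : nbr v c = some w)
    (hne : port (Finset.univ.filter fun c => (nbr w c).isSome) i ≠ some c) :
    (s t v).label i ≠ (s t w).label i := by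
  induction t with
  | zero =>
    rw [E.start, E.start]
    simp only [MatchState.start, hp, Option.elim_some]
    rcases h : port (Finset.univ.filter fun c => (nbr w c).isSome) i with _ | d
    · exact c.2.ne
    · rw [Option.elim_some]
      intro e
      rw [h, ← Fin.ext e] at hne
      exact hne rfl
  | succ t ih =>
    rw [E.label_succ (by omega) (by omega), E.label_succ (by omega) (by omega)]
    unfold MatchState.relabel
    rw [E.colours_eq (by omega), hp]
    simp only [Option.bind_some, MatchState.received, hvw, Option.map_some, Option.elim_some]
    exact coleVishkin_ne (ih (by omega) (by omega)) _

theorem label_lt (E : Execution R nbr s r) (hk : k < 4 * tower (max 1 R)) {t : ℕ} (ht : t ≤ r)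
    (htR : t ≤ R) (v : V) (i : ℕ) : (s t v).label i < 4 * tower (max 1 (R - t)) := by
  induction t generalizing v with
  | zero =>
    rw [E.start]
    refine lt_of_le_of_lt ?_ hk
    simp only [MatchState.start]
    rcases port (Finset.univ.filter fun c => (nbr v c).isSome) i with _ | c
    · exact le_rfl
    · exact c.2.le
  | succ t ih =>
    rw [E.label_succ (by omega) (by omega), ← Nat.sub_sub]
    refine coleVishkin_lt_tower (ih (by omega) (by omega) v) ?_
    rcases h : (port (s t v).colours i).bind (MatchState.received nbr (s t) v) with _ | u
    · exact ih (by omega) (by omega) v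
    · obtain ⟨c, -, hc⟩ := Option.bind_eq_some_iff.1 h
      obtain ⟨w, -, rfl⟩ := Option.map_eq_some_iff.1 hc
      exact ih (by omega) (by omega) w

theorem mate_succ (E : Execution R nbr s r) {t : ℕ} (ht : t < r) {v : V} {c : Fin k}
    (h : (s t v).mate = some c) : (s (t + 1) v).mate = some c := by
  rw [E.next t ht, MatchState.next]
  split_ifs <;> simp [MatchState.accept, MatchState.confirm, h]

theorem mate_mono (E : Execution R nbr s r) {t t' : ℕ} (htt' : t ≤ t') (ht : t' ≤ r) {v : V}
    (h : (s t v).mate ≠ none) : (s t' v).mate ≠ none := by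
  induction t', htt' using Nat.le_induction with
  | base => exact h
  | succ t' _ ih =>
    obtain ⟨c, hc⟩ := Option.ne_none_iff_exists'.1 (ih (by omega))
    rw [E.mate_succ (by omega) hc]
    exact Option.some_ne_none c

theorem proposal_iff (E : Execution R nbr s r) {t : ℕ} (ht : t ≤ r) (htR : R ≤ t) {i j : ℕ} {w : V}
    {c : Fin k} : (s t w).Proposal i j (MatchState.received nbr (s t) w) c ↔
      ∃ v, PhaseEdge nbr (fun v => Finset.univ.filter fun c => (nbr v c).isSome)
        (fun v => (s R v).label) i j w v c ∧ (s t v).mate = none := by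
  unfold MatchState.Proposal PhaseEdge MatchState.received
  constructor
  · rintro ⟨u, hu, h1, h2, h3⟩
    obtain ⟨v, hv, rfl⟩ := Option.map_eq_some_iff.1 hu
    rw [E.colours_eq ht] at h2 h3
    rw [E.label_eq ht htR] at h3
    exact ⟨v, ⟨hv, h2, h3⟩, h1⟩
  · rintro ⟨v, ⟨hv, h2, h3⟩, h1⟩
    refine ⟨s t v, by rw [hv]; rfl, h1, ?_, ?_⟩
    · rwa [E.colours_eq ht]
    · rwa [E.colours_eq ht, E.label_eq ht htR]

theorem matched (E : Execution R nbr s r) (hs : Reciprocal nbr) {q : ℕ} (hq : R + 2 * q ≤ r) :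
    Matched nbr fun v => (s (R + 2 * q) v).mate := by
  induction q with
  | zero =>
    intro v c h
    exact absurd h (by simp [E.mate_eq_none (show R ≤ r by omega) le_rfl])
  | succ q ih =>
    refine matched_of_phase hs (S := fun v => Finset.univ.filter fun c => (nbr v c).isSome)
      (x := fun v => (s R v).label) (i := q / 9) (j := q % 9)
      (m' := fun v => (s (R + 2 * q + 1) v).mate)
      (fun v w i c hp hvw hne => E.label_ne (by omega) le_rfl hp hvw hne) (ih (by omega)) ?_ ?_
    · intro w
      show (s (R + 2 * q + 1) w).mate = _
      rw [E.mate_accept (by omega), MatchState.accept]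
      congr 2
      funext c
      exact propext (E.proposal_iff (by omega) (by omega))
    · intro v
      show (s (R + 2 * q + 2) v).mate = _
      rw [E.mate_confirm (by omega), MatchState.confirm]
      congr 2
      funext c
      simp only [MatchState.received, Option.map_eq_some_iff, eq_iff_iff]
      constructor
      · rintro ⟨_, ⟨w, hw, rfl⟩, h⟩
        exact ⟨w, hw, h⟩
      · rintro ⟨w, hw, h⟩
        exact ⟨_, ⟨w, hw, rfl⟩, h⟩

/-- If `v` is still free when the phase begins, its proposal ensures that `w` is matched at the
latest by accepting one in this phase. -/
theorem covered (E : Execution R nbr s r) {i j : ℕ} (hj : j < 9) (hr : R + 2 * (9 * i + j) < r)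
    {w v : V} {c : Fin k}
    (h : PhaseEdge nbr (fun v => Finset.univ.filter fun c => (nbr v c).isSome)
        (fun v => (s R v).label) i j w v c) : (s r w).mate ≠ none ∨ (s r v).mate ≠ none := by
  by_cases hv : (s (R + 2 * (9 * i + j)) v).mate = none
  · left
    refine E.mate_mono (t := R + 2 * (9 * i + j) + 1) (by omega) le_rfl ?_
    rw [E.mate_accept hr, MatchState.accept, show (9 * i + j) / 9 = i by omega,
      show (9 * i + j) % 9 = j by omega]
    rcases (s (R + 2 * (9 * i + j)) w).mate with _ | d
    · exact MatchState.pick_ne_none ((E.proposal_iff (by omega) (by omega)).2 ⟨v, h, hv⟩)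
    · simp
  · exact Or.inr (E.mate_mono (by omega) le_rfl hv)

/-- Each edge is the `i`-th edge of its end `v` for some `i < Δ`, so it has its turn in phase `(i,
8)`, or in the phase of `i` and the reduced label of `v`. -/
theorem maximal (E : Execution R nbr s r) (hs : Reciprocal nbr) (hk : k < 4 * tower (max 1 R))
    {Δ : ℕ} (hΔ : ∀ v, (Finset.univ.filter fun c => (nbr v c).isSome).card ≤ Δ)
    (hr : r = R + 18 * Δ) {w v : V} {c : Fin k} (h : nbr w c = some v) :
    (s r w).mate ≠ none ∨ (s r v).mate ≠ none := by
  have hc : c ∈ Finset.univ.filter fun c => (nbr v c).isSome := by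
    simp [hs _ _ _ h]
  obtain ⟨i, hi, hp⟩ := exists_port_eq hc
  have hi' := hi.trans_le (hΔ v)
  by_cases hw : port (Finset.univ.filter fun c => (nbr w c).isSome) i = some c
  · exact E.covered (i := i) (j := 8) (by norm_num) (by omega) ⟨h, hp, by rwa [if_pos rfl]⟩
  · have hlt : (s R v).label i < 8 := by
      have := E.label_lt hk (t := R) (by omega) le_rfl v i
      rwa [Nat.sub_self] at this
    exact E.covered (i := i) (j := (s R v).label i) (by omega) (by omega)
      ⟨h, hp, by rw [if_neg (by omega)]; exact ⟨hw, rfl⟩⟩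

end Execution

/-- Reduce labels for `R` rounds, then process the phases until time `r`. -/
noncomputable def matchingAlgorithm (k R r : ℕ) : Algorithm k where
  State := MatchState k
  Msg := MatchState k
  init := MatchState.start
  send s _ := s
  update := MatchState.next R
  output s := if s.time < r then none else some s.mate

theorem execution_matchingAlgorithm (R r : ℕ) (nbr : V → Fin k → Option V) :
    Execution R nbr ((matchingAlgorithm k R r).runOn nbr) r := by
  have step : ∀ t v, ((matchingAlgorithm k R r).runOn nbr t v : MatchState k).time < r →
      (matchingAlgorithm k R r).runOn nbr (t + 1) v =
        MatchState.next R ((matchingAlgorithm k R r).runOn nbr t v)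
          (MatchState.received nbr ((matchingAlgorithm k R r).runOn nbr t) v) := by
    intro t v h
    rw [Algorithm.runOn, if_neg]
    · rfl
    · simp [matchingAlgorithm] at h ⊢
      exact h
  have time : ∀ t ≤ r, ∀ v, ((matchingAlgorithm k R r).runOn nbr t v : MatchState k).time = t := by
    intro t
    induction t with
    | zero => intro _ v; rfl
    | succ t ih =>
      intro ht v
      have h := ih (by omega) v
      exact (congrArg MatchState.time (step t v (by omega))).trans
        ((MatchState.time_next _ _ _).trans (by rw [h]))
  exact ⟨fun v => rfl, fun t ht v => step t v (by rw [time t ht.le]; exact ht)⟩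

theorem solvesAll_matchingAlgorithm {R Δ : ℕ} (hk : k < 4 * tower (max 1 R)) :
    (matchingAlgorithm k R (R + 18 * Δ)).SolvesAll Δ (R + 18 * Δ) := by
  intro V G hG
  set r := R + 18 * Δ with hr
  set A := matchingAlgorithm k R r
  have E := execution_matchingAlgorithm R r G.neighbour
  have hs := G.reciprocal_neighbour
  have hΔ : ∀ v, (Finset.univ.filter fun c => (G.neighbour v c).isSome).card ≤ Δ := by
    intro v
    have := hG v
    rw [G.encard_neighborSet, G.incidentColours_eq] at this
    exact_mod_cast this
  have hM := E.matched hs (q := 9 * Δ) (by omega)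
  rw [show R + 2 * (9 * Δ) = r by omega] at hM
  refine ⟨fun v => (A.runOn G.neighbour r v : MatchState k).mate, fun v => ?_, ?_, ?_, ?_⟩
  · rw [G.stateAfter_eq_runOn]
    exact if_neg (by rw [E.time_eq le_rfl]; exact lt_irrefl r)
  · intro v c h
    obtain ⟨w, hw, -⟩ := hM v c h
    rw [G.incidentColours_eq]
    simp [hw]
  · intro v w c h hvw
    obtain ⟨u, hu, hmu⟩ := hM v c h
    rw [G.neighbour_eq_some.2 hvw, Option.some_inj] at hu
    rwa [hu]
  · intro v w h hvw
    obtain ⟨c, hc⟩ := G.exists_joins_iff.2 hvw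
    exact (E.maximal hs hk hΔ hr (G.neighbour_eq_some.2 hc)).resolve_left fun h' => h' h

end EdgeColouredLocal
open EdgeColouredLocal in
/-- First part: the lower bound `Ω(Δ)`. Second part: the complexity is `Θ(Δ + log* k)`.
The lower bounds already hold for algorithms that only have to work on finite graphs of maximum
degree exactly `Δ`; the algorithms of the upper bound work on all graphs of maximum degree at
most `Δ`. All constants are absolute. -/
theorem mainTheorem3 :
    (∃ a : ℝ, 0 < a ∧ ∀ Δ k : ℕ, 2 ≤ Δ → Δ ≤ k →
      ∀ (A : Algorithm k) (r : ℕ), A.SolvesFinite Δ r → a * (Δ : ℝ) ≤ (r : ℝ)) ∧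
    (∃ b B : ℝ, 0 < b ∧ 0 < B ∧ ∀ Δ k : ℕ, 2 ≤ Δ → Δ ≤ k →
      (∀ (A : Algorithm k) (r : ℕ), A.SolvesFinite Δ r →
        b * ((Δ : ℝ) + (logStar (k : ℝ) : ℝ)) ≤ (r : ℝ)) ∧
      (∃ (A : Algorithm k) (r : ℕ), A.SolvesAll Δ r ∧
        (r : ℝ) ≤ B * ((Δ : ℝ) + (logStar (k : ℝ) : ℝ)))) := by
  have lower : ∀ Δ k : ℕ, 2 ≤ Δ → Δ ≤ k → ∀ (A : Algorithm k) (r : ℕ), A.SolvesFinite Δ r →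
      (Δ : ℝ) ≤ 3 * r := by
    intro Δ k hΔ hk A r hA
    have h1 := hA.sub_two_le hΔ hk
    have h2 := hA.pos hΔ hk
    have h3 : Δ ≤ 3 * r := by omega
    exact_mod_cast h3
  -- From `Δ ≤ r + 2`, `log* k ≤ 2r + 3` and `r ≥ 1` come `Δ ≤ 3r` and `log* k ≤ 5r`, hence `1/3`
  -- and `1/8`. The 18 counts two rounds for each of nine phases per index.
  refine ⟨⟨1 / 3, by norm_num, fun Δ k hΔ hk A r hA => ?_⟩, 1 / 8, 18, by norm_num, by norm_num,
    fun Δ k hΔ hk => ⟨fun A r hA => ?_, ?_⟩⟩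
  · linarith [lower Δ k hΔ hk A r hA]
  · have h1 := lower Δ k hΔ hk A r hA
    have h2 := hA.pos hΔ hk
    have h3 : logStar (k : ℝ) ≤ 2 * r + 3 := logStar_le (by exact_mod_cast hA.le_tower hΔ hk)
    have h4 : (logStar (k : ℝ) : ℝ) ≤ 5 * r := by
      have : logStar (k : ℝ) ≤ 5 * r := by omega
      exact_mod_cast this
    linarith
  · refine ⟨_, _, solvesAll_matchingAlgorithm (R := logStar (k : ℝ)) ?_, ?_⟩
    · have h1 := le_tower_logStar k
      have h2 : 1 ≤ logStar (k : ℝ) := by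
        by_contra! h0
        rw [show logStar (k : ℝ) = 0 by omega, tower_zero] at h1
        omega
      rw [max_eq_right h2]
      omega
    · push_cast
      have : (0 : ℝ) ≤ logStar (k : ℝ) := Nat.cast_nonneg _
      linarith
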